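/- Let $\Gamma$ be a finite connected simple graph that has no induced subgraph isomorphic to $C_4$ (the cycle with $4$ edges) or to $L_3$ (the path with $3$ edges, on $4$ vertices). Let $G$ be the right-angled Artin group with defining graph $\Gamma$, that is, the group with the presentation $$G=\langle V(\Gamma)\mid ab=ba \text{ for every edge } \{a,b\} \text{ of } \Gamma\rangle .$$ Then $G$ admits a regular left-order: there is a strict total order $\prec$ on $G$, with $a\prec b \Leftrightarrow ca\prec cb$ for all $a,b,c\in G$, together with a finite set $X$, a surjective monoid homomorphism $\pi\colon X^*\to G$ and a regular language $\mathcal L\subseteq X^*$ (one accepted by a finite state automaton), such that $\pi(\mathcal L)$ is the positive cone $\{g\in G\mid 1\prec g\}$. -/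

import Mathlib

/-- The relators `a * b * (b * a)⁻¹`, one for each pair of adjacent vertices `a`, `b`. -/
def raagRelators {V : Type*} (Γ : SimpleGraph V) : Set (FreeGroup V) :=
  {r | ∃ a b : V, Γ.Adj a b ∧
    r = FreeGroup.of a * FreeGroup.of b * (FreeGroup.of b * FreeGroup.of a)⁻¹}

/-- The right-angled Artin group with defining graph `Γ`: it is generated by the vertices of `Γ`,
with the relation `a * b = b * a` for each edge `{a, b}` of `Γ` (an Artin group all of whose edges
have label `2`). -/
abbrev RightAngledArtinGroup {V : Type*} (Γ : SimpleGraph V) : Type _ :=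
  PresentedGroup (raagRelators Γ)

/-- `lt` is a left-order on `G`: a strict total order with `a ≺ b ↔ c * a ≺ c * b`. -/
structure IsLeftOrder {G : Type*} [Group G] (lt : G → G → Prop) : Prop where
  irrefl : ∀ a, ¬ lt a a
  trans : ∀ a b c, lt a b → lt b c → lt a c
  total : ∀ a b, lt a b ∨ a = b ∨ lt b a
  mul_left_iff : ∀ a b c, lt a b ↔ lt (c * a) (c * b)

/-- The positive cone of an order: the set of elements greater than `1`. -/
def positiveCone {G : Type*} [Group G] (lt : G → G → Prop) : Set G :=
  {g | lt 1 g}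

/-- A subset `S` of a group `G` is represented by a regular language: for some finite (monoid)
generating set of `G`, that is, a finite alphabet `X` with a surjective monoid homomorphism
`π : X* → G`, there is a regular language `L ⊆ X*` that evaluates onto `S`, i.e. `π(L) = S`. -/
def IsRegularSubset {G : Type*} [Group G] (S : Set G) : Prop :=
  ∃ (X : Type) (_ : Finite X) (π : FreeMonoid X →* G), Function.Surjective π ∧
    ∃ L : Language X, L.IsRegular ∧ ∀ g : G, g ∈ S ↔ ∃ w ∈ L, π (FreeMonoid.ofList w) = g

/-- A regular left-order: a left-order whose positive cone is represented by a regular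
language. -/
def IsRegularLeftOrder {G : Type*} [Group G] (lt : G → G → Prop) : Prop :=
  IsLeftOrder lt ∧ IsRegularSubset (positiveCone lt)

/-! The proof is by induction on the number of vertices. A vertex `v` of maximal degree in `Γ` is
adjacent to all others (`SimpleGraph.Connected.exists_forall_adj`), so `G` is the product of an
infinite cyclic group `⟨z⟩` and the group of `Γ - v`, which is the free product of the groups `G i`
of the components of `Γ - v`. These components inherit the hypotheses.

It remains to order `(∗ G i) × ℤ`, given rational positive cones of the factors. The weight `τ` of a
normal form adds a sign `±1` for each syllable and a sign `±1` for each rise or fall of the index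
between neighbouring syllables. With `n > 0` syllables there are `2n - 1` signs, so `τ` is odd off
`1`; also `τ(g⁻¹) = -τ(g)`, and `τ` is additive up to an error of at most `1`
(`abs_groupWeight_mul_le`). Hence `τ(g) + 2n > 0` defines a positive cone.

It is rational because `z` lets a finite graph avoid counting: each syllable, together with the jump
before it, contributes an even number, which is cancelled at once by a power of `z`. Only the last
index has to be remembered, and what is left over is a bounded-below power of `z` (`mem_cone_iff`).

Rationality is phrased with arbitrary monoid elements as edge labels, so that no alphabet is fixed
until `IsRational.isRegularSubset`. -/

/-! ### Rational subsets of monoids -/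

/-- `LabelledPath E p g q`: there is a path from `p` to `q` in the graph with labelled edges `E`
whose labels multiply to `g`. -/
inductive LabelledPath {Q M : Type*} [Monoid M] (E : Q → M → Q → Prop) : Q → M → Q → Prop
  | nil (p : Q) : LabelledPath E p 1 p
  | cons {p : Q} {a : M} {q : Q} {g : M} {r : Q} :
      E p a q → LabelledPath E q g r → LabelledPath E p (a * g) r

namespace LabelledPath

variable {Q Q' M N : Type*} [Monoid M] [Monoid N] {E : Q → M → Q → Prop}

theorem single {p q : Q} {a : M} (h : E p a q) : LabelledPath E p a q := by
  simpa using cons h (nil q)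

theorem trans {p q r : Q} {a b : M} (h₁ : LabelledPath E p a q) (h₂ : LabelledPath E q b r) :
    LabelledPath E p (a * b) r := by
  induction h₁ with
  | nil => simpa using h₂
  | cons he _ ih => rw [mul_assoc]; exact cons he (ih h₂)

theorem map {E' : Q' → N → Q' → Prop} (f : Q → Q') (φ : M →* N)
    (hE : ∀ p a q, E p a q → E' (f p) (φ a) (f q)) {p q : Q} {g : M}
    (h : LabelledPath E p g q) : LabelledPath E' (f p) (φ g) (f q) := by
  induction h with
  | nil => rw [map_one]; exact nil _
  | cons he _ ih => rw [map_mul]; exact cons (hE _ _ _ he) ih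

theorem exists_of_map {E' : Q → N → Q → Prop} (φ : M →* N)
    (hE : ∀ p b q, E' p b q → ∃ a, E p a q ∧ φ a = b) {p q : Q} {g : N}
    (h : LabelledPath E' p g q) : ∃ x, LabelledPath E p x q ∧ φ x = g := by
  induction h with
  | nil p => exact ⟨1, nil p, map_one φ⟩
  | cons he _ ih =>
    obtain ⟨a, ha, rfl⟩ := hE _ _ _ he
    obtain ⟨x, hx, rfl⟩ := ih
    exact ⟨a * x, cons ha hx, map_mul φ a x⟩

theorem inv {G : Type*} [Group G] {E : Q → G → Q → Prop} {p q : Q} {g : G}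
    (h : LabelledPath E p g q) : LabelledPath (fun p a q => E q a⁻¹ p) q g⁻¹ p := by
  induction h with
  | nil => rw [inv_one]; exact nil _
  | cons he _ ih =>
    rw [mul_inv_rev]
    exact ih.trans (single (by simpa using he))

end LabelledPath

/-- A subset of a monoid is rational if it is the set of labels of paths between two given
vertices in a finite labelled graph. -/
def IsRational {M : Type*} [Monoid M] (S : Set M) : Prop :=
  ∃ (Q : Type) (_ : Finite Q) (E : Q → M → Q → Prop) (s t : Q),
    {e : Q × M × Q | E e.1 e.2.1 e.2.2}.Finite ∧ ∀ g, g ∈ S ↔ LabelledPath E s g t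

namespace IsRational

variable {M N : Type*} [Monoid M] [Monoid N]

theorem of_finite {S : Set M} (hS : S.Finite) : IsRational S := by
  refine ⟨Bool, inferInstance, fun p a q => p = false ∧ a ∈ S ∧ q = true, false, true, ?_, ?_⟩
  · refine (((Set.finite_singleton false).prod (hS.prod (Set.finite_singleton true)))).subset ?_
    rintro ⟨p, a, q⟩ ⟨h₁, h₂, h₃⟩
    exact ⟨h₁, h₂, h₃⟩
  · intro g
    refine ⟨fun h => .single ⟨rfl, h, rfl⟩, fun h => ?_⟩
    generalize hs : false = s at h
    generalize ht : true = t at h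
    cases h with
    | nil => simp [← hs] at ht
    | cons he h' =>
      obtain ⟨-, ha, rfl⟩ := he
      cases h' with
      | nil => simpa using ha
      | cons he' => exact Bool.noConfusion (ht.trans (he'.1.trans hs.symm))

theorem map (φ : M →* N) {S : Set M} (h : IsRational S) : IsRational (φ '' S) := by
  obtain ⟨Q, hQ, E, s, t, hE, hS⟩ := h
  refine ⟨Q, hQ, fun p b q => ∃ a, E p a q ∧ φ a = b, s, t, ?_, ?_⟩
  · refine (hE.image fun e => (e.1, φ e.2.1, e.2.2)).subset ?_
    rintro ⟨p, b, q⟩ ⟨a, ha, rfl⟩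
    exact ⟨(p, a, q), ha, rfl⟩
  · intro g
    constructor
    · rintro ⟨x, hx, rfl⟩
      exact ((hS x).1 hx).map id φ fun p a q h => ⟨a, h, rfl⟩
    · intro h
      obtain ⟨x, hx, rfl⟩ := h.exists_of_map φ fun p b q h => h
      exact ⟨x, (hS x).2 hx, rfl⟩

theorem inv {G : Type*} [Group G] {S : Set G} (h : IsRational S) : IsRational {g | g⁻¹ ∈ S} := by
  obtain ⟨Q, hQ, E, s, t, hE, hS⟩ := h
  refine ⟨Q, hQ, fun p a q => E q a⁻¹ p, t, s, ?_, ?_⟩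
  · refine (hE.image fun e => (e.2.2, e.2.1⁻¹, e.1)).subset ?_
    rintro ⟨p, a, q⟩ h
    exact ⟨(q, a⁻¹, p), h, by simp⟩
  · intro g
    rw [Set.mem_ofPred_eq, hS]
    constructor
    · intro h; simpa using h.inv
    · intro h; simpa using h.inv

/-- Rational subsets may be substituted for the labels of a finite graph. -/
theorem substitution {Q ι : Type} [Finite Q] [Finite ι] (src tgt : ι → Q) (R : ι → Set M)
    (hR : ∀ e, IsRational (R e)) (s t : Q) :
    IsRational {g | LabelledPath (fun p a q => ∃ e, src e = p ∧ tgt e = q ∧ a ∈ R e) s g t} := by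
  choose K hK F i o hF hR using hR
  -- Each edge `e` becomes a copy of the graph recognizing `R e`, entered and left by edges labelled
  -- `1`.
  let E : Q ⊕ (Σ e, K e) → M → Q ⊕ (Σ e, K e) → Prop := fun p a q =>
    (∃ e, p = .inl (src e) ∧ a = 1 ∧ q = .inr ⟨e, i e⟩) ∨
    (∃ e, p = .inr ⟨e, o e⟩ ∧ a = 1 ∧ q = .inl (tgt e)) ∨
    (∃ e x y, p = .inr ⟨e, x⟩ ∧ F e x a y ∧ q = .inr ⟨e, y⟩)
  refine ⟨Q ⊕ (Σ e, K e), inferInstance, E, .inl s, .inl t, ?_, fun g => ⟨fun h => ?_, fun h => ?_⟩⟩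
  · refine (((Set.finite_range fun e => ((.inl (src e), 1, .inr ⟨e, i e⟩) :
        (Q ⊕ (Σ e, K e)) × M × (Q ⊕ (Σ e, K e))))).union
      ((Set.finite_range fun e => ((.inr ⟨e, o e⟩, 1, .inl (tgt e)) :
        (Q ⊕ (Σ e, K e)) × M × (Q ⊕ (Σ e, K e)))).union
      (Set.finite_iUnion fun e => (hF e).image fun x => ((.inr ⟨e, x.1⟩, x.2.1, .inr ⟨e, x.2.2⟩) :
        (Q ⊕ (Σ e, K e)) × M × (Q ⊕ (Σ e, K e)))))).subset ?_
    rintro ⟨p, a, q⟩ (⟨e, rfl, rfl, rfl⟩ | ⟨e, rfl, rfl, rfl⟩ | ⟨e, x, y, rfl, h, rfl⟩)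
    · exact .inl ⟨e, rfl⟩
    · exact .inr (.inl ⟨e, rfl⟩)
    · exact .inr (.inr (Set.mem_iUnion.2 ⟨e, (x, a, y), h, rfl⟩))
  · change LabelledPath _ s g t at h
    induction h with
    | nil => exact .nil _
    | cons he _ ih =>
      obtain ⟨e, rfl, rfl, ha⟩ := he
      have h₁ := ((hR e _).1 ha).map (E' := E) (fun x => .inr ⟨e, x⟩) (MonoidHom.id M)
        fun p a q h => .inr (.inr ⟨e, p, q, rfl, h, rfl⟩)
      have h₂ : E (.inl (src e)) 1 (.inr ⟨e, i e⟩) := .inl ⟨e, rfl, rfl, rfl⟩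
      have h₃ : E (.inr ⟨e, o e⟩) 1 (.inl (tgt e)) := .inr (.inl ⟨e, rfl, rfl, rfl⟩)
      simpa using (LabelledPath.cons h₂ (h₁.trans (.single h₃))).trans ih
  -- A path starting inside the copy for `e` is cut where it first leaves that copy.
  · have key : ∀ p q, LabelledPath E p g q → q = .inl t →
        (∀ x, p = .inl x → LabelledPath
          (fun p a q => ∃ e, src e = p ∧ tgt e = q ∧ a ∈ R e) x g t) ∧
        (∀ e x, p = .inr ⟨e, x⟩ → ∃ a b, a * b = g ∧ LabelledPath (F e) x a (o e) ∧ LabelledPath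
          (fun p a q => ∃ e, src e = p ∧ tgt e = q ∧ a ∈ R e) (tgt e) b t) := by
      clear h
      intro p q h
      induction h with
      | nil p =>
        rintro rfl
        refine ⟨fun x hx => ?_, fun e x hx => by simp at hx⟩
        obtain rfl := Sum.inl_injective hx
        exact .nil _
      | cons he _ ih =>
        intro hq
        obtain ⟨ih₁, ih₂⟩ := ih hq
        obtain ⟨e, rfl, rfl, rfl⟩ | ⟨e, rfl, rfl, rfl⟩ | ⟨e, x, y, rfl, h, rfl⟩ := he
        · refine ⟨fun x hx => ?_, fun e x hx => by simp at hx⟩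
          obtain rfl := Sum.inl_injective hx
          obtain ⟨a, b, rfl, ha, hb⟩ := ih₂ e _ rfl
          rw [one_mul]
          exact .cons ⟨e, rfl, rfl, (hR e a).2 ha⟩ hb
        · refine ⟨fun x hx => by simp at hx, fun e' x hx => ?_⟩
          obtain ⟨rfl, hx⟩ := Sigma.mk.inj (Sum.inr_injective hx)
          obtain rfl := eq_of_heq hx
          exact ⟨1, _, rfl, .nil _, ih₁ _ rfl⟩
        · refine ⟨fun x hx => by simp at hx, fun e' x hx => ?_⟩
          obtain ⟨rfl, hx⟩ := Sigma.mk.inj (Sum.inr_injective hx)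
          obtain rfl := eq_of_heq hx
          obtain ⟨a, b, rfl, ha, hb⟩ := ih₂ e _ rfl
          exact ⟨_ * a, b, mul_assoc _ _ _, .cons h ha, hb⟩
    exact (key _ _ h rfl).1 s rfl

theorem union {S T : Set M} (hS : IsRational S) (hT : IsRational T) : IsRational (S ∪ T) := by
  have h := substitution (fun _ : Bool => false) (fun _ : Bool => true)
    (fun b => bif b then S else T) (by simp [hS, hT]) false true
  convert h using 1
  ext g
  constructor
  · rintro (h | h)
    · exact .single ⟨true, rfl, rfl, h⟩
    · exact .single ⟨false, rfl, rfl, h⟩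
  · intro h
    rw [Set.mem_ofPred_eq] at h
    generalize hs : false = s at h
    generalize ht : true = t at h
    cases h with
    | nil => simp [← hs] at ht
    | cons he h' =>
      obtain ⟨b, -, rfl, ha⟩ := he
      cases h' with
      | nil => cases b <;> simp_all
      | cons he' =>
        obtain ⟨-, h₁, -⟩ := he'
        simp [← hs, ← ht] at h₁

theorem mul_singleton {S : Set M} (hS : IsRational S) (c : M) : IsRational ((· * c) '' S) := by
  have h := substitution (fun b : Bool => bif b then (1 : Fin 3) else 0)
    (fun b : Bool => bif b then (2 : Fin 3) else 1)
    (fun b => bif b then {c} else S) (by simp [hS, of_finite]) 0 2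
  convert h using 1
  ext g
  constructor
  · rintro ⟨x, hx, rfl⟩
    exact .trans (.single ⟨false, rfl, rfl, hx⟩) (.single ⟨true, rfl, rfl, rfl⟩)
  · intro h
    rw [Set.mem_ofPred_eq] at h
    generalize hs : (0 : Fin 3) = s at h
    generalize ht : (2 : Fin 3) = t at h
    cases h with
    | nil => simp [← hs] at ht
    | cons he h' =>
      obtain ⟨b, hb, hq, ha⟩ := he
      cases b with
      | true => simp [← hs] at hb
      | false =>
        cases h' with
        | nil => simp [← ht] at hq
        | cons he' h'' =>
          obtain ⟨b, hb', hr, ha'⟩ := he'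
          cases b with
          | false => subst hs ht hq; simp at hb'
          | true =>
            cases h'' with
            | nil => exact ⟨_, ha, by simp [show _ = c from ha']⟩
            | cons he'' =>
              obtain ⟨b, hb'', -⟩ := he''
              cases b with
              | false => subst hs ht hr; simp at hb''
              | true => subst hs ht hr; simp at hb''

/-- A rational subset of a finitely generated group is represented by a regular language. -/
theorem isRegularSubset {G : Type*} [Group G] [hG : Group.FG G] {S : Set G} (h : IsRational S) :
    IsRegularSubset S := by
  obtain ⟨Q, hQ, E, s, t, hE, hS⟩ := h
  obtain ⟨A, hA, hAf⟩ := Monoid.fg_iff.1 (Group.fg_iff_monoid_fg.1 hG)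
  have := hAf.to_subtype
  have := hE.to_subtype
  obtain ⟨n, ⟨e⟩⟩ := Finite.exists_equiv_fin {e : Q × G × Q | E e.1 e.2.1 e.2.2}
  obtain ⟨m, ⟨f⟩⟩ := Finite.exists_equiv_fin A
  -- The letters are the edges of the graph, plus monoid generators of `G` which no transition reads
  -- and which only make `π` surjective.
  let π : FreeMonoid (Fin n ⊕ Fin m) →* G :=
    FreeMonoid.lift (Sum.elim (fun k => (e.symm k).1.2.1) (fun k => (f.symm k).1))
  let T : NFA (Fin n ⊕ Fin m) Q :=
    { step := fun p x => {q | ∃ k, x = .inl k ∧ (e.symm k).1.1 = p ∧ (e.symm k).1.2.2 = q}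
      start := {s}
      accept := {t} }
  have hT : ∀ p g, LabelledPath E p g t ↔
      ∃ w ∈ T.acceptsFrom {p}, π (FreeMonoid.ofList w) = g := by
    intro p g
    constructor
    · intro h
      generalize ht : t = t' at h
      induction h with
      | nil p =>
        subst ht
        exact ⟨[], by simp [T], map_one π⟩
      | @cons p a q g r he _ ih =>
        obtain ⟨w, hw, rfl⟩ := ih ht
        refine ⟨.inl (e ⟨(p, a, q), he⟩) :: w, ?_, ?_⟩
        · rw [NFA.cons_mem_acceptsFrom, NFA.stepSet_singleton]
          rw [NFA.mem_acceptsFrom] at hw ⊢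
          obtain ⟨t', ht', hw⟩ := hw
          refine ⟨t', ht', T.mem_evalFrom_iff_exists.2 ⟨q, ⟨_, rfl, ?_, ?_⟩, hw⟩⟩ <;> simp
        · rw [FreeMonoid.ofList_cons, map_mul]
          simp [π]
    · rintro ⟨w, hw, rfl⟩
      induction w generalizing p with
      | nil =>
        obtain rfl : p = t := by simpa [T] using hw
        exact .nil _
      | cons x w ih =>
        rw [NFA.cons_mem_acceptsFrom, NFA.stepSet_singleton, NFA.mem_acceptsFrom] at hw
        obtain ⟨t', ht', hw⟩ := hw
        obtain ⟨q, ⟨k, rfl, rfl, rfl⟩, hw⟩ := T.mem_evalFrom_iff_exists.1 hw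
        rw [FreeMonoid.ofList_cons, map_mul]
        have h₁ : π (FreeMonoid.of (.inl k)) = (e.symm k).1.2.1 := by simp [π]
        rw [h₁]
        exact .cons (e.symm k).2 (ih _ (NFA.mem_acceptsFrom.2 ⟨t', ht', hw⟩))
  refine ⟨Fin n ⊕ Fin m, inferInstance, π, ?_, T.accepts, ?_, fun g => (hS g).trans (hT s g)⟩
  · rw [← MonoidHom.mrange_eq_top, eq_top_iff, ← hA, Submonoid.closure_le]
    intro a ha
    exact ⟨FreeMonoid.of (.inr (f ⟨a, ha⟩)), by simp [π]⟩
  · have := Fintype.ofFinite Q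
    exact ⟨Set Q, inferInstance, T.toDFA, T.toDFA_correct⟩

end IsRational

/-! ### Positive cones -/

/-- `P` is the positive cone of a left-order. -/
structure IsPositiveCone {G : Type*} [Group G] (P : Set G) : Prop where
  one_notMem : 1 ∉ P
  mul_mem : ∀ {a b}, a ∈ P → b ∈ P → a * b ∈ P
  mem_or_inv_mem : ∀ {a}, a ≠ 1 → a ∈ P ∨ a⁻¹ ∈ P

namespace IsPositiveCone

variable {G : Type*} [Group G] {P : Set G}

theorem inv_notMem (hP : IsPositiveCone P) {a : G} (ha : a ∈ P) : a⁻¹ ∉ P := fun h =>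
  hP.one_notMem (by simpa using hP.mul_mem ha h)

theorem isLeftOrder (hP : IsPositiveCone P) : IsLeftOrder fun a b : G => a⁻¹ * b ∈ P where
  irrefl a h := hP.one_notMem (by simpa using h)
  trans a b c h₁ h₂ := by simpa [mul_assoc] using hP.mul_mem h₁ h₂
  total a b := by
    by_cases h : a = b
    · exact .inr (.inl h)
    · rcases hP.mem_or_inv_mem (a := a⁻¹ * b) (by rwa [Ne, inv_mul_eq_one]) with h | h
      · exact .inl h
      · exact .inr (.inr (by simpa using h))
  mul_left_iff a b c := by simp [mul_assoc]

theorem map {H : Type*} [Group H] (hP : IsPositiveCone P) (e : G ≃* H) :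
    IsPositiveCone (e '' P) where
  one_notMem := by
    rintro ⟨x, hx, h⟩
    rw [EmbeddingLike.map_eq_one_iff] at h
    exact hP.one_notMem (h ▸ hx)
  mul_mem := by
    rintro _ _ ⟨x, hx, rfl⟩ ⟨y, hy, rfl⟩
    exact ⟨x * y, hP.mul_mem hx hy, map_mul e x y⟩
  mem_or_inv_mem {a} ha := by
    rcases hP.mem_or_inv_mem (a := e.symm a) (by simpa using ha) with h | h
    · exact .inl ⟨_, h, by simp⟩
    · exact .inr ⟨_, h, by simp⟩

end IsPositiveCone

open Classical in
/-- The sign of a nontrivial element with respect to a positive cone. -/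
noncomputable def coneSign {G : Type*} (P : Set G) (x : G) : ℤ := if x ∈ P then 1 else -1

section coneSign

variable {G : Type*} {P : Set G}

theorem coneSign_of_mem {x : G} (h : x ∈ P) : coneSign P x = 1 := if_pos h

theorem coneSign_of_notMem {x : G} (h : x ∉ P) : coneSign P x = -1 := if_neg h

theorem coneSign_eq_or (P : Set G) (x : G) : coneSign P x = 1 ∨ coneSign P x = -1 := by
  by_cases h : x ∈ P
  · exact .inl (coneSign_of_mem h)
  · exact .inr (coneSign_of_notMem h)

theorem coneSign_inv [Group G] (hP : IsPositiveCone P) {x : G} (hx : x ≠ 1) :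
    coneSign P x⁻¹ = -coneSign P x := by
  by_cases h : x ∈ P
  · rw [coneSign_of_mem h, coneSign_of_notMem (hP.inv_notMem h)]
  · rw [coneSign_of_notMem h, coneSign_of_mem ((hP.mem_or_inv_mem hx).resolve_left h), neg_neg]

/-- Up to the convention at `1`, this is the sum of the signs of `x⁻¹ * y`, `y⁻¹` and `x`. Their
product is `1`, so they are not all positive or all negative, and the sum cannot be `±3`. -/
theorem abs_coneSign_inv_mul_le [Group G] (hP : IsPositiveCone P) {x y : G} (hx : x ≠ 1)
    (hy : y ≠ 1) :
    |coneSign P (x⁻¹ * y) - coneSign P y + coneSign P x| ≤ 1 := by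
  by_cases h₁ : x ∈ P <;> by_cases h₂ : y ∈ P
  · rw [coneSign_of_mem h₁, coneSign_of_mem h₂]
    rcases coneSign_eq_or P (x⁻¹ * y) with h | h <;> simp [h]
  · have h₃ : (x⁻¹ * y)⁻¹ ∈ P := by
      simpa using hP.mul_mem ((hP.mem_or_inv_mem hy).resolve_left h₂) h₁
    rw [coneSign_of_mem h₁, coneSign_of_notMem h₂,
      coneSign_of_notMem (by simpa using hP.inv_notMem h₃)]
    simp
  · rw [coneSign_of_notMem h₁, coneSign_of_mem h₂,
      coneSign_of_mem (hP.mul_mem ((hP.mem_or_inv_mem hx).resolve_left h₁) h₂)]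
    simp
  · rw [coneSign_of_notMem h₁, coneSign_of_notMem h₂]
    rcases coneSign_eq_or P (x⁻¹ * y) with h | h <;> simp [h]

end coneSign

/-! ### Reduced lists and their weights -/

namespace FreeProductOrder

open Monoid

/-- The sign of the jump between two indices, `0` if one of them is missing. -/
def jump {ι : Type*} [LinearOrder ι] : Option ι → Option ι → ℤ
  | some i, some j => if i < j then 1 else if j < i then -1 else 0
  | _, _ => 0

/-- `a` and `b` are not the same index. -/
def Apart {ι : Type*} (a b : Option ι) : Prop := ∀ i, a = some i → b ≠ some i

section jump

variable {ι : Type*}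

theorem Apart.symm {a b : Option ι} (h : Apart a b) : Apart b a := fun i hb ha => h i ha hb

@[simp] theorem apart_none_left (b : Option ι) : Apart none b := fun _ h => nomatch h

@[simp] theorem apart_none_right (b : Option ι) : Apart b none := fun _ _ h => nomatch h

@[simp] theorem apart_some_some {i j : ι} : Apart (some i) (some j) ↔ i ≠ j :=
  ⟨fun h hij => h i rfl (hij ▸ rfl), fun h _ hi hj =>
    h ((Option.some_injective _ hi).trans (Option.some_injective _ hj).symm)⟩

variable [LinearOrder ι]

@[simp] theorem jump_none_left (b : Option ι) : jump none b = 0 := rfl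

@[simp] theorem jump_none_right (a : Option ι) : jump a none = 0 := by cases a <;> rfl

theorem jump_some_some {i j : ι} (h : i ≠ j) :
    jump (some i) (some j) = 1 ∨ jump (some i) (some j) = -1 := by
  rcases lt_or_gt_of_ne h with h | h
  · simp [jump, h]
  · simp [jump, h, h.not_gt]

theorem abs_jump_le (a b : Option ι) : |jump a b| ≤ 1 := by
  rcases a with _ | i <;> rcases b with _ | j
  · simp
  · simp
  · simp
  · simp only [jump]
    split_ifs <;> simp

theorem jump_swap (a b : Option ι) : jump a b = -jump b a := by
  rcases a with _ | i <;> rcases b with _ | j <;> simp only [jump, neg_zero]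
  rcases lt_trichotomy i j with h | h | h
  · simp [h, h.not_gt]
  · simp [h]
  · simp [h, h.not_gt]

/-- For three distinct indices this adds the jumps along the cycle `i → k → c → i`, which cannot all
rise or all fall. -/
theorem abs_jump_triangle_le {i k : ι} (c : Option ι) (hik : i ≠ k) :
    |jump (some i) (some k) - jump c (some k) + jump c (some i)| ≤ 1 := by
  rcases c with _ | c
  · simpa using abs_jump_le (some i) (some k)
  · simp only [jump]
    rcases lt_or_gt_of_ne hik with h | h <;> split_ifs <;> simp <;> order

end jump

section lists

variable {ι : Type*} {G : ι → Type*}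

/-- The index of the first syllable. -/
def fstIdx (l : List (Σ i, G i)) : Option ι := l.head?.map Sigma.fst

@[simp] theorem fstIdx_nil : fstIdx ([] : List (Σ i, G i)) = none := rfl

@[simp] theorem fstIdx_cons (x : Σ i, G i) (l) : fstIdx (x :: l) = some x.1 := rfl

variable [∀ i, Group (G i)]

/-- Reduced lists of syllables: no syllable is trivial and adjacent ones lie in different
factors. -/
def Reduced : List (Σ i, G i) → Prop
  | [] => True
  | x :: l => x.2 ≠ 1 ∧ Apart (some x.1) (fstIdx l) ∧ Reduced l

theorem reduced_iff {l : List (Σ i, G i)} :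
    Reduced l ↔ (∀ x ∈ l, x.2 ≠ 1) ∧ l.IsChain fun x y => x.1 ≠ y.1 := by
  induction l with
  | nil => simp [Reduced]
  | cons x l ih =>
    rw [Reduced, ih]
    cases l with
    | nil => simp
    | cons y l => simp; tauto

/-- The product of a list of syllables in the free product. -/
def listProd (l : List (Σ i, G i)) : CoprodI G := (l.map fun x => CoprodI.of x.2).prod

@[simp] theorem listProd_nil : listProd ([] : List (Σ i, G i)) = 1 := rfl

@[simp] theorem listProd_cons (x : Σ i, G i) (l) :
    listProd (x :: l) = CoprodI.of x.2 * listProd l := by simp [listProd]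

/-- The list `u⁻¹ ++ v`. -/
def invAppend : List (Σ i, G i) → List (Σ i, G i) → List (Σ i, G i)
  | [], v => v
  | x :: u, v => invAppend u (⟨x.1, x.2⁻¹⟩ :: v)

theorem listProd_invAppend (u v : List (Σ i, G i)) :
    listProd (invAppend u v) = (listProd u)⁻¹ * listProd v := by
  induction u generalizing v with
  | nil => simp [invAppend]
  | cons x u ih => simp [invAppend, ih, mul_assoc]

theorem Reduced.invAppend {u v : List (Σ i, G i)} (hu : Reduced u) (hv : Reduced v)
    (h : Apart (fstIdx u) (fstIdx v)) : Reduced (invAppend u v) := by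
  induction u generalizing v with
  | nil => exact hv
  | cons x u ih => exact ih hu.2.2 ⟨by simpa using hu.1, h, hv⟩ hu.2.1.symm

variable {P : ∀ i, Set (G i)}

variable (P) in
/-- The pairs of a syllable `x` and the power of the central generator which compensates the
contribution of `x` to the weight. -/
def syllables (d : ℤ) (i : ι) : Set (CoprodI G × Multiplicative ℤ) :=
  {g | ∃ (x : G i) (k : ℤ), x ≠ 1 ∧ coneSign (P i) x + d + 2 * k = 0 ∧
    g = (CoprodI.of x, Multiplicative.ofAdd k)}

theorem isRational_syllables {i : ι} (hP : IsPositiveCone (P i)) (hr : IsRational (P i)) {d : ℤ}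
    (hd : Odd d) : IsRational (syllables P d i) := by
  obtain ⟨m, rfl⟩ := hd
  let φ : G i →* CoprodI G × Multiplicative ℤ := (MonoidHom.inl _ _).comp CoprodI.of
  convert ((hr.map φ).mul_singleton (1, Multiplicative.ofAdd (-m - 1))).union
    ((hr.inv.map φ).mul_singleton (1, Multiplicative.ofAdd (-m))) using 1
  ext g
  constructor
  · rintro ⟨x, k, hx, hk, rfl⟩
    by_cases h : x ∈ P i
    · rw [coneSign_of_mem h] at hk
      obtain rfl : k = -m - 1 := by lia
      exact .inl ⟨_, ⟨x, h, rfl⟩, by simp [φ]⟩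
    · rw [coneSign_of_notMem h] at hk
      obtain rfl : k = -m := by lia
      exact .inr ⟨_, ⟨x, (hP.mem_or_inv_mem hx).resolve_left h, rfl⟩, by simp [φ]⟩
  · rintro (⟨_, ⟨x, hx, rfl⟩, rfl⟩ | ⟨_, ⟨x, hx, rfl⟩, rfl⟩)
    · refine ⟨x, -m - 1, ?_, ?_, by simp [φ]⟩
      · rintro rfl
        exact hP.one_notMem hx
      · rw [coneSign_of_mem hx]
        ring
    · refine ⟨x, -m, ?_, ?_, by simp [φ]⟩
      · rintro rfl
        exact hP.one_notMem (by simpa using hx)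
      · rw [coneSign_of_notMem fun h => hP.inv_notMem h hx]
        ring

variable [LinearOrder ι]

variable (P) in
/-- The number of positive syllables minus the number of negative ones, plus the number of
increases of the index minus the number of decreases. -/
noncomputable def weight : List (Σ i, G i) → ℤ
  | [] => 0
  | x :: l => coneSign (P x.1) x.2 + jump (some x.1) (fstIdx l) + weight l

theorem weight_invAppend (hP : ∀ i, IsPositiveCone (P i)) {u : List (Σ i, G i)} (hu : Reduced u)
    (v : List (Σ i, G i)) :
    weight P (invAppend u v) = -weight P u + weight P v + jump (fstIdx u) (fstIdx v) := by
  induction u generalizing v with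
  | nil => simp [invAppend, weight]
  | cons x u ih =>
    rw [invAppend, ih hu.2.2]
    simp only [weight, fstIdx_cons, coneSign_inv (hP _) hu.1]
    rw [jump_swap (fstIdx u)]
    ring

theorem odd_weight {l : List (Σ i, G i)} (hl : Reduced l) (h : l ≠ []) : Odd (weight P l) := by
  induction l with
  | nil => exact absurd rfl h
  | cons x l ih =>
    have hs : Odd (coneSign (P x.1) x.2) := by
      rcases coneSign_eq_or (P x.1) x.2 with h | h <;> rw [h] <;> decide
    rw [weight]
    cases l with
    | nil => simpa [weight] using hs
    | cons y l =>
      have hj : Odd (jump (some x.1) (fstIdx (y :: l))) := by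
        rcases jump_some_some (apart_some_some.1 hl.2.1) with h | h <;> rw [fstIdx_cons, h] <;>
          decide
      exact (hs.add_odd hj).add_odd (ih hl.2.2 (List.cons_ne_nil _ _))

/-- The near-additivity of the weight, by induction on the cancellation between `u⁻¹` and `v`. The
index `c` is that of the syllable cancelled last; its jumps to `u` and `v` are carried along so that
a full cancellation leaves the error unchanged. An error arises only once, where cancellation stops.
-/
theorem exists_reduced_inv_mul (hP : ∀ i, IsPositiveCone (P i)) (u : List (Σ i, G i)) :
    ∀ (v : List (Σ i, G i)) (c : Option ι), Reduced u → Reduced v → Apart c (fstIdx u) →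
      Apart c (fstIdx v) →
      ∃ w, Reduced w ∧ listProd w = (listProd u)⁻¹ * listProd v ∧
        |weight P w - (weight P v - weight P u + jump c (fstIdx v) - jump c (fstIdx u))| ≤ 1 := by
  induction u with
  | nil =>
    intro v c _ hv _ _
    refine ⟨v, hv, by simp, ?_⟩
    simpa [weight] using abs_jump_le c (fstIdx v)
  | cons x u ih =>
    intro v c hu hv hcu hcv
    rcases v with _ | ⟨y, v⟩
    · refine ⟨invAppend (x :: u) [], hu.invAppend hv (by simp), listProd_invAppend _ _, ?_⟩
      rw [weight_invAppend hP hu]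
      simpa [weight] using abs_jump_le c (some x.1)
    · obtain ⟨i, x⟩ := x
      obtain ⟨k, y⟩ := y
      by_cases hik : i = k
      · subst hik
        -- Equal heads cancel and the induction continues with `c = i`; distinct heads in one factor
        -- merge into a single syllable.
        by_cases hxy : x = y
        · subst hxy
          obtain ⟨w, hw, hp, hb⟩ := ih v (some i) hu.2.2 hv.2.2 hu.2.1 hv.2.1
          refine ⟨w, hw, by simp [hp, mul_assoc], ?_⟩
          refine le_of_eq_of_le (congrArg _ ?_) hb
          simp only [weight, fstIdx_cons]
          ring
        · refine ⟨invAppend u (⟨i, x⁻¹ * y⟩ :: v), hu.2.2.invAppend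
            ⟨by simpa [inv_mul_eq_one] using hxy, hv.2.1, hv.2.2⟩ hu.2.1.symm, ?_, ?_⟩
          · simp [listProd_invAppend, mul_assoc]
          · rw [weight_invAppend hP hu.2.2]
            refine le_of_eq_of_le (congrArg _ ?_) (abs_coneSign_inv_mul_le (hP i) hu.1 hv.1)
            simp only [weight, fstIdx_cons]
            rw [jump_swap (fstIdx u)]
            ring
      · refine ⟨invAppend (⟨i, x⟩ :: u) (⟨k, y⟩ :: v), hu.invAppend hv (by simpa using hik),
          listProd_invAppend _ _, ?_⟩
        rw [weight_invAppend hP hu]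
        refine le_of_eq_of_le (congrArg _ ?_) (abs_jump_triangle_le c hik)
        simp only [fstIdx_cons]
        ring

open Classical in
theorem existsUnique_reduced (g : CoprodI G) : ∃! l : List (Σ i, G i), Reduced l ∧ listProd l = g := by
  refine ⟨(CoprodI.Word.equiv g).toList, ⟨reduced_iff.2 ⟨(CoprodI.Word.equiv g).ne_one,
    (CoprodI.Word.equiv g).chain_ne⟩, CoprodI.Word.equiv.symm_apply_apply g⟩, ?_⟩
  rintro l ⟨hl, rfl⟩
  rw [reduced_iff] at hl
  exact congrArg CoprodI.Word.toList (CoprodI.Word.equiv.apply_symm_apply ⟨l, hl.1, hl.2⟩).symm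

variable (P) in
/-- The weight of an element of the free product is the weight of its normal form. -/
noncomputable def groupWeight (g : CoprodI G) : ℤ := weight P (existsUnique_reduced g).choose

theorem groupWeight_listProd {l : List (Σ i, G i)} (hl : Reduced l) :
    groupWeight P (listProd l) = weight P l := by
  rw [groupWeight, (existsUnique_reduced (listProd l)).unique
    (existsUnique_reduced (listProd l)).choose_spec.1 ⟨hl, rfl⟩]

theorem groupWeight_one : groupWeight P 1 = 0 :=
  groupWeight_listProd (l := []) trivial

theorem groupWeight_inv (hP : ∀ i, IsPositiveCone (P i)) (g : CoprodI G) :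
    groupWeight P g⁻¹ = -groupWeight P g := by
  obtain ⟨l, ⟨hl, rfl⟩, -⟩ := existsUnique_reduced g
  have h := groupWeight_listProd (P := P) (hl.invAppend (v := []) trivial (by simp))
  rw [listProd_invAppend, weight_invAppend hP hl] at h
  simpa [weight, groupWeight_listProd hl] using h

theorem odd_groupWeight {g : CoprodI G} (hg : g ≠ 1) : Odd (groupWeight P g) := by
  obtain ⟨l, ⟨hl, rfl⟩, -⟩ := existsUnique_reduced g
  rw [groupWeight_listProd hl]
  refine odd_weight hl ?_
  rintro rfl
  exact hg rfl

theorem abs_groupWeight_mul_le (hP : ∀ i, IsPositiveCone (P i)) (g h : CoprodI G) :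
    |groupWeight P (g * h) - (groupWeight P g + groupWeight P h)| ≤ 1 := by
  -- Taking the normal form of `g⁻¹` puts the cancellation in `g * h` at the heads of two lists.
  obtain ⟨u, ⟨hu, hug⟩, -⟩ := existsUnique_reduced g⁻¹
  obtain ⟨v, ⟨hv, rfl⟩, -⟩ := existsUnique_reduced h
  obtain ⟨w, hw, hp, hb⟩ := exists_reduced_inv_mul hP u v none hu hv (by simp) (by simp)
  have hg : g = (listProd u)⁻¹ := by rw [hug, inv_inv]
  rw [hg, groupWeight_inv hP, ← hp, groupWeight_listProd hw, groupWeight_listProd hu,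
    groupWeight_listProd hv]
  refine le_of_eq_of_le (congrArg _ ?_) hb
  simp only [jump_none_left]
  ring

/-! ### The product of a free product with the integers -/

variable (P) in
/-- The positive cone of the product of the free product with the integers. -/
def cone : Set (CoprodI G × Multiplicative ℤ) :=
  {g | 0 < groupWeight P g.1 + 2 * g.2.toAdd}

theorem isPositiveCone_cone (hP : ∀ i, IsPositiveCone (P i)) : IsPositiveCone (cone P) where
  one_notMem := by simp [cone, groupWeight_one]
  mul_mem {a b} ha hb := by
    -- Both values are at least `1`, so an error of at most `1` leaves their sum positive.
    have h := abs_le.1 (abs_groupWeight_mul_le hP a.1 b.1)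
    simp only [cone, Set.mem_ofPred_eq, Prod.fst_mul, Prod.snd_mul, toAdd_mul] at ha hb ⊢
    lia
  mem_or_inv_mem {a} ha := by
    obtain ⟨g, n⟩ := a
    simp only [cone, Set.mem_ofPred_eq, Prod.fst_inv, Prod.snd_inv, toAdd_inv, groupWeight_inv hP]
    by_cases hg : g = 1
    · subst hg
      have hn : n.toAdd ≠ 0 := fun h => ha (Prod.ext rfl h)
      rw [groupWeight_one]
      lia
    · obtain ⟨m, hm⟩ := odd_groupWeight (P := P) hg
      lia

/-- The jump between two indices, where a missing first index counts as a negative jump. -/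
def startJump : Option ι → Option ι → ℤ
  | none, _ => -1
  | some i, a => jump (some i) a

/-- The extra `-1` at the start gives the first syllable a jump too, so that every syllable has an
even total to compensate. It also turns the strict inequality of the cone into `0 ≤ ...`. -/
theorem startJump_eq_or {c : Option ι} {i : ι} (h : Apart c (some i)) :
    startJump c (some i) = 1 ∨ startJump c (some i) = -1 := by
  rcases c with _ | c
  · exact .inr rfl
  · exact jump_some_some (apart_some_some.1 h)

variable (P) in
/-- The labels of a graph which recognizes the cone. The vertex `none` is the final one,
`some none` is the initial one, and the others record the index of the last syllable. -/
def label : Option (Option ι) → Option (Option ι) → Set (CoprodI G × Multiplicative ℤ)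
  | some c, some (some i) => {g | Apart c (some i) ∧ g ∈ syllables P (startJump c (some i)) i}
  | some (some _), none => {1}
  | some none, none => {(1, Multiplicative.ofAdd 1)}
  | none, none => {(1, Multiplicative.ofAdd 1)}
  | _, some none => ∅
  | none, some (some _) => ∅

theorem path_none (n : ℕ) : LabelledPath (fun p g q => g ∈ label P p q) none
    (1, Multiplicative.ofAdd (n : ℤ)) none := by
  induction n with
  | zero => exact .nil _
  | succ n ih =>
    have h : (1, Multiplicative.ofAdd (1 : ℤ)) ∈ label P none none := rfl
    convert LabelledPath.cons h ih using 1
    rw [Prod.mk_mul_mk, ← ofAdd_add, mul_one, Nat.cast_succ, add_comm]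

/-- The inequality is invariant along the path: reading a syllable with its compensating power of
`z` removes a total of `0` from it. -/
theorem path_of_nonneg {l : List (Σ i, G i)} (hl : Reduced l) :
    ∀ {c : Option ι} {n : ℤ}, Apart c (fstIdx l) →
      0 ≤ startJump c (fstIdx l) + weight P l + 2 * n →
      LabelledPath (fun p g q => g ∈ label P p q) (some c)
        (listProd l, Multiplicative.ofAdd n) none := by
  induction l with
  | nil =>
    intro c n _ h
    rcases c with _ | c
    · simp only [startJump, weight] at h
      -- For the empty normal form, `0 ≤ -1 + 2 * n` forces `1 ≤ n`; hence the label `z` from the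
      -- initial to the final vertex.
      obtain ⟨m, rfl⟩ : ∃ m : ℕ, n = 1 + m := ⟨(n - 1).toNat, by lia⟩
      have h : (1, Multiplicative.ofAdd (1 : ℤ)) ∈ label P (some none) none := rfl
      convert LabelledPath.cons h (path_none m) using 1
      rw [Prod.mk_mul_mk, ← ofAdd_add, mul_one, listProd_nil]
    · simp only [startJump, weight, fstIdx_nil, jump_none_right] at h
      obtain ⟨m, rfl⟩ : ∃ m : ℕ, n = m := ⟨n.toNat, by lia⟩
      have h : 1 ∈ label P (some (some c)) none := rfl
      simpa using LabelledPath.cons h (path_none m)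
  | cons x l ih =>
    intro c n hc h
    obtain ⟨k, hk⟩ : ∃ k, coneSign (P x.1) x.2 + startJump c (some x.1) + 2 * k = 0 := by
      rcases coneSign_eq_or (P x.1) x.2 with h₁ | h₁ <;>
        rcases startJump_eq_or hc with h₂ | h₂ <;> rw [h₁, h₂]
      · exact ⟨-1, rfl⟩
      · exact ⟨0, rfl⟩
      · exact ⟨0, rfl⟩
      · exact ⟨1, rfl⟩
    have h₁ : (CoprodI.of x.2, Multiplicative.ofAdd k) ∈ label P (some c) (some (some x.1)) :=
      ⟨hc, x.2, k, hl.1, hk, rfl⟩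
    have h₂ := ih hl.2.2 (c := some x.1) (n := n - k) hl.2.1 (by
      simp only [startJump, weight, fstIdx_cons] at h hk ⊢
      lia)
    convert LabelledPath.cons h₁ h₂ using 1
    rw [listProd_cons, Prod.mk_mul_mk, ← ofAdd_add, add_sub_cancel]

theorem of_path {p q : Option (Option ι)} {g : CoprodI G × Multiplicative ℤ}
    (h : LabelledPath (fun p g q => g ∈ label P p q) p g q) (hq : q = none) :
    (p = none → g.1 = 1 ∧ 0 ≤ g.2.toAdd) ∧
    ∀ c, p = some c → ∃ l : List (Σ i, G i), Reduced l ∧ Apart c (fstIdx l) ∧ listProd l = g.1 ∧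
      0 ≤ startJump c (fstIdx l) + weight P l + 2 * g.2.toAdd := by
  induction h with
  | nil p => simp [hq]
  | @cons p a q g r he _ ih =>
    obtain ⟨ih₁, ih₂⟩ := ih hq
    rcases p with _ | c
    · refine ⟨fun _ => ?_, by simp⟩
      rcases q with _ | _ | i
      · obtain rfl : a = _ := he
        obtain ⟨h₁, h₂⟩ := ih₁ rfl
        refine ⟨by simp [h₁], ?_⟩
        rw [Prod.snd_mul, toAdd_mul, toAdd_ofAdd]
        lia
      · exact he.elim
      · exact he.elim
    · refine ⟨by simp, fun c' hc => ?_⟩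
      obtain rfl := Option.some_injective _ hc
      rcases q with _ | _ | i
      · obtain ⟨h₁, h₂⟩ := ih₁ rfl
        refine ⟨[], trivial, by simp, ?_⟩
        rcases c with _ | c
        · obtain rfl : a = _ := he
          refine ⟨by simp [h₁], ?_⟩
          rw [Prod.snd_mul, toAdd_mul, toAdd_ofAdd]
          simp only [startJump, weight]
          lia
        · obtain rfl : a = _ := he
          refine ⟨by simp [h₁], ?_⟩
          simp only [startJump, weight, one_mul, fstIdx_nil, jump_none_right]
          lia
      · rcases c with _ | c <;> exact he.elim
      · obtain ⟨hc, x, k, hx, hk, rfl⟩ := he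
        obtain ⟨l, hl, hil, hp, hw⟩ := ih₂ _ rfl
        refine ⟨⟨i, x⟩ :: l, ⟨hx, hil, hl⟩, hc, by simp [hp], ?_⟩
        rw [Prod.snd_mul, toAdd_mul, toAdd_ofAdd]
        simp only [startJump, weight, fstIdx_cons] at hw hk ⊢
        lia

theorem mem_cone_iff (g : CoprodI G × Multiplicative ℤ) :
    g ∈ cone P ↔ LabelledPath (fun p g q => g ∈ label P p q) (some none) g none := by
  constructor
  · intro h
    obtain ⟨l, ⟨hl, hlg⟩, -⟩ := existsUnique_reduced g.1
    have h₁ := path_of_nonneg (P := P) hl (c := none) (n := g.2.toAdd) (by simp) (by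
      rw [cone, Set.mem_ofPred_eq, ← hlg, groupWeight_listProd hl] at h
      simp only [startJump]
      lia)
    rwa [hlg] at h₁
  · intro h
    obtain ⟨l, hl, -, hlg, hw⟩ := (of_path h rfl).2 none rfl
    rw [cone, Set.mem_ofPred_eq, ← hlg, groupWeight_listProd hl]
    simp only [startJump] at hw
    lia

theorem isRational_label (hP : ∀ i, IsPositiveCone (P i)) (hr : ∀ i, IsRational (P i))
    (p q : Option (Option ι)) : IsRational (label P p q) := by
  rcases p with _ | c <;> rcases q with _ | _ | i
  · exact .of_finite (Set.finite_singleton _)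
  · exact .of_finite Set.finite_empty
  · exact .of_finite Set.finite_empty
  · rcases c with _ | c <;> exact .of_finite (Set.finite_singleton _)
  · rcases c with _ | c <;> exact .of_finite Set.finite_empty
  · by_cases h : Apart c (some i)
    · simp only [label, h, true_and]
      refine isRational_syllables (hP i) (hr i) ?_
      rcases startJump_eq_or h with h | h <;> rw [h] <;> decide
    · simp only [label, h, false_and]
      exact .of_finite Set.finite_empty

end lists

theorem isRational_cone {n : ℕ} {G : Fin n → Type*} [∀ i, Group (G i)] {P : ∀ i, Set (G i)}
    (hP : ∀ i, IsPositiveCone (P i)) (hr : ∀ i, IsRational (P i)) : IsRational (cone P) := by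
  convert IsRational.substitution Prod.fst Prod.snd
    (fun e : Option (Option (Fin n)) × Option (Option (Fin n)) => label P e.1 e.2)
    (fun e => isRational_label hP hr e.1 e.2) (some none) none using 1
  ext g
  rw [mem_cone_iff, Set.mem_ofPred_eq]
  congr! with p a q
  simp

end FreeProductOrder

/-! ### Right-angled Artin groups -/

namespace RightAngledArtinGroup

variable {V : Type*} {Γ : SimpleGraph V}

/-- The generator of a right-angled Artin group which belongs to a vertex. -/
def of (Γ : SimpleGraph V) (a : V) : RightAngledArtinGroup Γ := PresentedGroup.of a

theorem commute_of {a b : V} (h : Γ.Adj a b) : Commute (of Γ a) (of Γ b) :=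
  PresentedGroup.mk_eq_mk_of_mul_inv_mem (rels := raagRelators Γ) ⟨a, b, h, rfl⟩

/-- The homomorphism given by images of the vertices, those of adjacent vertices commuting. -/
def lift {H : Type*} [Group H] (f : V → H) (hf : ∀ a b, Γ.Adj a b → Commute (f a) (f b)) :
    RightAngledArtinGroup Γ →* H :=
  PresentedGroup.toGroup (f := f) (by
    rintro _ ⟨a, b, h, rfl⟩
    simp only [map_mul, map_inv, FreeGroup.lift_apply_of]
    rw [(hf a b h).eq, mul_inv_cancel])

@[simp] theorem lift_of {H : Type*} [Group H] (f : V → H)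
    (hf : ∀ a b, Γ.Adj a b → Commute (f a) (f b)) (a : V) : lift f hf (of Γ a) = f a :=
  PresentedGroup.toGroup.of _

theorem hom_ext {H : Type*} [Group H] {f g : RightAngledArtinGroup Γ →* H}
    (h : ∀ a, f (of Γ a) = g (of Γ a)) : f = g :=
  PresentedGroup.ext h

instance [Finite V] : Group.FG (RightAngledArtinGroup Γ) :=
  Group.fg_iff.2 ⟨_, PresentedGroup.closure_range_of _, Set.finite_range _⟩

/-- If `φ` is constant on edges, then the group is the free product of those of the fibres. -/
def equivCoprodI {ι : Type*} (φ : V → ι) (hφ : ∀ a b, Γ.Adj a b → φ a = φ b) :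
    RightAngledArtinGroup Γ ≃*
      Monoid.CoprodI fun i => RightAngledArtinGroup (Γ.induce {a | φ a = i}) :=
  MonoidHom.toMulEquiv
    (lift (fun a => Monoid.CoprodI.of (i := φ a) (of (Γ.induce {b | φ b = φ a}) ⟨a, rfl⟩)) (by
      intro a b h
      -- This moves the generator `b` into the factor indexed by `φ a`, where it can be compared
      -- with `a`.
      have key : ∀ (i : ι) (hi : φ b = i), (Monoid.CoprodI.of (i := φ b)
          (of (Γ.induce {c | φ c = φ b}) ⟨b, rfl⟩) :
          Monoid.CoprodI fun i => RightAngledArtinGroup (Γ.induce {a | φ a = i})) =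
          Monoid.CoprodI.of (i := i) (of (Γ.induce {c | φ c = i}) ⟨b, hi⟩) := by
        rintro _ rfl
        rfl
      rw [key _ (hφ a b h).symm]
      exact (commute_of (Γ := Γ.induce {c | φ c = φ a}) (a := ⟨a, rfl⟩)
        (b := ⟨b, (hφ a b h).symm⟩) h).map _))
    (Monoid.CoprodI.lift fun i => lift (fun a => of Γ a.1) fun _ _ h => commute_of h)
    (hom_ext fun a => by simp)
    (Monoid.CoprodI.ext_hom _ _ fun i => hom_ext (by
      rintro ⟨a, rfl⟩
      simp))

theorem prod_hom_ext {M N H : Type*} [Monoid M] [Monoid N] [Monoid H] {f g : M × N →* H}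
    (h₁ : f.comp (MonoidHom.inl M N) = g.comp (MonoidHom.inl M N))
    (h₂ : f.comp (MonoidHom.inr M N) = g.comp (MonoidHom.inr M N)) : f = g := by
  ext1 ⟨m, n⟩
  rw [← Prod.fst_mul_snd (m, n), map_mul, map_mul]
  exact congrArg₂ _ (DFunLike.congr_fun h₁ m) (DFunLike.congr_fun h₂ n)

open Classical in
/-- A vertex adjacent to all the others splits off a central infinite cyclic factor. -/
noncomputable def equivProdInt (v : V) (hv : ∀ a, a ≠ v → Γ.Adj v a) :
    RightAngledArtinGroup Γ ≃*
      RightAngledArtinGroup (Γ.induce {a | a ≠ v}) × Multiplicative ℤ :=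
  MonoidHom.toMulEquiv
    (lift (fun a => if h : a = v then (1, Multiplicative.ofAdd 1) else
        (of (Γ.induce {a | a ≠ v}) ⟨a, h⟩, 1)) (by
      intro a b h
      by_cases ha : a = v <;> by_cases hb : b = v
      · simp [ha, hb]
      · simp [ha, hb, Prod.commute_iff]
      · simp [ha, hb, Prod.commute_iff]
      · simp only [ha, hb, dite_false]
        exact Prod.commute_iff.2
          ⟨commute_of (Γ := Γ.induce {a | a ≠ v}) h, Commute.one_left _⟩))
    (MonoidHom.noncommCoprod (lift (fun a => of Γ a.1) fun _ _ h => commute_of h)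
      (zpowersHom _ (of Γ v)) (by
        intro m n
        rw [zpowersHom_apply]
        refine Commute.zpow_right ?_ _
        -- Conjugation by `v` fixes the generators, hence the whole image of the first factor.
        have h : (MulAut.conj (of Γ v)).toMonoidHom.comp
            (lift (Γ := Γ.induce {a | a ≠ v}) (fun a => of Γ a.1) fun _ _ h => commute_of h) =
            lift (fun a => of Γ a.1) fun _ _ h => commute_of h :=
          hom_ext fun a => by simp [(commute_of (hv a.1 a.2)).eq]
        exact (mul_inv_eq_iff_eq_mul.1 (DFunLike.congr_fun h m)).symm))
    (hom_ext fun a => by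
      by_cases h : a = v
      · simp [h]
      · simp [h])
    (prod_hom_ext (hom_ext fun a => by simp [show a.1 ≠ v from a.2]) (MonoidHom.ext_mint (by simp)))

end RightAngledArtinGroup

/-! ### Existence of a dominating vertex -/

namespace SimpleGraph

theorem Connected.exists_forall_adj {V : Type*} [Finite V] {Γ : SimpleGraph V}
    (hconn : Γ.Connected) (hC4 : ¬ (cycleGraph 4).IsIndContained Γ)
    (hL3 : ¬ (pathGraph 4).IsIndContained Γ) : ∃ v, ∀ a, a ≠ v → Γ.Adj v a := by
  classical
  have := Fintype.ofFinite V
  have := hconn.nonempty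
  obtain ⟨v, hv⟩ := Finite.exists_max fun v => Γ.degree v
  refine ⟨v, ?_⟩
  by_contra! ⟨a, hav, ha⟩
  -- A walk from `v` to `a` leaves the closed neighbourhood of `v`, giving a vertex `w` at distance
  -- two.
  obtain ⟨u, w, hu, hw, huw⟩ : ∃ u w, Γ.Adj v u ∧ (w ≠ v ∧ ¬ Γ.Adj v w) ∧ Γ.Adj u w := by
    obtain ⟨p⟩ := hconn.preconnected v a
    obtain ⟨d, -, hd₁, hd₂⟩ := p.exists_boundary_dart {b | b = v ∨ Γ.Adj v b} (.inl rfl)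
      (by simp [hav, ha])
    simp only [Set.mem_ofPred_eq, not_or] at hd₁ hd₂
    rcases hd₁ with hd₁ | hd₁
    · exact absurd (hd₁ ▸ d.adj) hd₂.2
    · exact ⟨d.fst, d.snd, hd₁, hd₂, d.adj⟩
  -- Since `w` is adjacent to `u` but not to `v`, maximality of the degree of `v` forces a neighbour
  -- `x ≠ u` of `v` not adjacent to `u`. Then `x, v, u, w` induce `C₄` or `L₃`, according to whether
  -- `x` and `w` are adjacent.
  obtain ⟨x, hx, hxu⟩ : ∃ x ∈ (Γ.neighborFinset v).erase u, x ∉ (Γ.neighborFinset u).erase v := by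
    by_contra! h
    have h₁ : (Γ.neighborFinset v).erase u ⊂ (Γ.neighborFinset u).erase v :=
      Finset.ssubset_iff_subset_ne.2 ⟨h, fun he => by
        have : w ∈ (Γ.neighborFinset u).erase v := by simp [hw.1, huw]
        rw [← he] at this
        simp [hw.2] at this⟩
    have h₂ := Finset.card_lt_card h₁
    rw [Finset.card_erase_of_mem (by simpa using hu),
      Finset.card_erase_of_mem (by simpa using hu.symm), card_neighborFinset_eq_degree,
      card_neighborFinset_eq_degree] at h₂
    have := hv u
    lia
  simp only [Finset.mem_erase, mem_neighborFinset, ne_eq, not_and] at hx hxu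
  have hxv : x ≠ v := hx.2.ne'
  have hux : ¬ Γ.Adj u x := hxu hxv
  have hxw : x ≠ w := fun h => hw.2 (h ▸ hx.2)
  have hxu' : ¬ Γ.Adj x u := fun h => hux h.symm
  have hwv : ¬ Γ.Adj w v := fun h => hw.2 h.symm
  have hinj : Function.Injective ![x, v, u, w] := by
    intro i j
    fin_cases i <;> fin_cases j <;>
      simp [hxv, hxv.symm, hx.1, Ne.symm hx.1, hxw, hxw.symm, hu.ne, hu.ne', hw.1, hw.1.symm, huw.ne,
        huw.ne']
  by_cases hadj : Γ.Adj x w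
  · refine hC4 ⟨⟨⟨![x, v, u, w], hinj⟩, fun {i j} => ?_⟩⟩
    fin_cases i <;> fin_cases j <;>
      simp [cycleGraph_adj, hx.2, hx.2.symm, hux, hxu', hu, hu.symm, hw.2, hwv, huw, huw.symm, hadj,
        hadj.symm] <;> decide
  · have hadj' : ¬ Γ.Adj w x := fun h => hadj h.symm
    refine hL3 ⟨⟨⟨![x, v, u, w], hinj⟩, fun {i j} => ?_⟩⟩
    fin_cases i <;> fin_cases j <;>
      simp [pathGraph_adj, hx.2, hx.2.symm, hux, hxu', hu, hu.symm, hw.2, hwv, huw, huw.symm, hadj,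
        hadj']

end SimpleGraph

/-! ### The induction and the main theorem -/

theorem RightAngledArtinGroup.exists_isRational_isPositiveCone (n : ℕ) :
    ∀ {V : Type*} [Finite V] (Γ : SimpleGraph V), Nat.card V = n → Γ.Connected →
      ¬ (SimpleGraph.cycleGraph 4).IsIndContained Γ →
      ¬ (SimpleGraph.pathGraph 4).IsIndContained Γ →
      ∃ P : Set (RightAngledArtinGroup Γ), IsPositiveCone P ∧ IsRational P := by
  induction n using Nat.strong_induction_on with
  | _ n ih =>
    intro V _ Γ hn hconn hC4 hL3
    obtain ⟨v, hv⟩ := hconn.exists_forall_adj hC4 hL3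
    set Δ := Γ.induce {a | a ≠ v} with hΔ
    obtain ⟨m, ⟨e⟩⟩ := Finite.exists_equiv_fin Δ.ConnectedComponent
    let φ : {a | a ≠ v} → Fin m := fun a => e (Δ.connectedComponentMk a)
    have hφ : ∀ a b, Δ.Adj a b → φ a = φ b := fun a b h =>
      congrArg e (SimpleGraph.ConnectedComponent.connectedComponentMk_eq_of_adj h)
    have hfib : ∀ i, ∃ P : Set (RightAngledArtinGroup (Δ.induce {a | φ a = i})),
        IsPositiveCone P ∧ IsRational P := by
      intro i
      have hemb : (Δ.induce {a | φ a = i}).IsIndContained Γ :=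
        ⟨(SimpleGraph.Embedding.induce _).trans (SimpleGraph.Embedding.induce _)⟩
      refine ih _ ?_ _ rfl ?_ (fun h => hC4 (h.trans hemb)) (fun h => hL3 (h.trans hemb))
      · rw [← hn]
        refine (Finite.card_subtype_le _).trans_lt ?_
        exact Finite.card_subtype_lt (x := v) (by simp)
      · have h := (e.symm i).connected_toSimpleGraph
        have hs : {a | φ a = i} = (e.symm i).supp := by
          ext a
          simp [φ, Equiv.eq_symm_apply]
        rw [hs]
        exact h
    choose P hP hr using hfib
    let E := ((equivProdInt v hv).trans
      ((equivCoprodI φ hφ).prodCongr (MulEquiv.refl (Multiplicative ℤ)))).symm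
    exact ⟨E '' FreeProductOrder.cone P, (FreeProductOrder.isPositiveCone_cone hP).map E,
      (FreeProductOrder.isRational_cone hP hr).map E.toMonoidHom⟩

/-- `SimpleGraph.cycleGraph 4` is the cycle with four edges, and `SimpleGraph.pathGraph 4` is the
path on four vertices, i.e. with three edges. -/
theorem mainTheorem10 {V : Type*} [Finite V] (Γ : SimpleGraph V) (hconn : Γ.Connected)
    (hC4 : ¬ (SimpleGraph.cycleGraph 4).IsIndContained Γ)
    (hL3 : ¬ (SimpleGraph.pathGraph 4).IsIndContained Γ) :
    ∃ lt : RightAngledArtinGroup Γ → RightAngledArtinGroup Γ → Prop,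
      IsRegularLeftOrder lt := by
  obtain ⟨P, hP, hr⟩ :=
    RightAngledArtinGroup.exists_isRational_isPositiveCone _ Γ rfl hconn hC4 hL3
  refine ⟨fun a b => a⁻¹ * b ∈ P, hP.isLeftOrder, ?_⟩
  simpa [positiveCone] using hr.isRegularSubset
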